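/- Let $R$ be a commutative ring and $I$ an ideal of $R$. We say that $I$ is regular if it contains a non-zerodivisor of $R$. The Ratliff-Rush closure of $I$ is $\widetilde I=\bigcup_{n\ge 1}(I^n:I^{n-1})$, and a regular ideal $I$ is called Ratliff-Rush closed if $\widetilde I=I$. An element $a\in I$ is called superficial for $I$ if there is a positive integer $c$ such that $(I^n:a)\cap I^c=I^{n-1}$ for all $n>c$. **Proposition 2.4.** Let $d\ge 2$ and $l\ge 3$ be integers, let $F$ be a field, let $R=F[X_1,\dots,X_d]$, and let $I\subseteq R$ be the ideal generated by all monomials of degree $l$ except $X_1^{l-1}X_2$. Then for every element $a\in I$ that is superficial for $I$, the ideal $I/(a)$ of $R/(a)$ is regular and is not Ratliff-Rush closed. More precisely, $X_1^{l-1}X_2\in \bigl((I^2+(a)):I\bigr)\setminus I$. -/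

import Mathlib

/-- A regular ideal: an ideal which contains a non-zerodivisor. -/
def IsRegularIdeal {R : Type*} [CommRing R] (I : Ideal R) : Prop :=
  ∃ x ∈ I, x ∈ nonZeroDivisors R

theorem ratliffRush_colon_mono {R : Type*} [CommRing R] (I : Ideal R) {m n : ℕ} (h : m ≤ n)
    {x : R} (hx : x ∈ (I ^ (m + 1)).colon (I ^ m : Ideal R)) :
    x ∈ (I ^ (n + 1)).colon (I ^ n : Ideal R) := by
  induction n, h using Nat.le_induction with
  | base => exact hx
  | succ n _ ih =>
    rw [Submodule.mem_colon] at ih ⊢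
    intro p hp
    rw [SetLike.mem_coe, pow_succ] at hp
    induction hp using Submodule.mul_induction_on' with
    | mem_mul_mem u hu v hv =>
      have := Ideal.mul_mem_mul (ih u hu) hv
      rw [← pow_succ] at this
      simpa [smul_eq_mul, mul_assoc] using this
    | add u _ v _ hu hv => rw [smul_add]; exact add_mem hu hv

/-- The Ratliff-Rush closure of `I`: the union over `n ≥ 0` of the colon ideals
`I ^ (n + 1) : I ^ n`. The colon ideals increase with `n`, so the union is an ideal. -/
def ratliffRushClosure {R : Type*} [CommRing R] (I : Ideal R) : Ideal R where
  carrier := {x | ∃ n : ℕ, x ∈ (I ^ (n + 1)).colon (I ^ n : Ideal R)}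
  zero_mem' := ⟨0, zero_mem _⟩
  add_mem' := by
    rintro x y ⟨m, hm⟩ ⟨n, hn⟩
    exact ⟨max m n, add_mem (ratliffRush_colon_mono I (le_max_left m n) hm)
      (ratliffRush_colon_mono I (le_max_right m n) hn)⟩
  smul_mem' := by
    rintro r x ⟨n, hn⟩
    exact ⟨n, Submodule.smul_mem _ r hn⟩

/-- A regular ideal is Ratliff-Rush closed if it equals its Ratliff-Rush closure. -/
def IsRatliffRushClosed {R : Type*} [CommRing R] (I : Ideal R) : Prop :=
  IsRegularIdeal I ∧ ratliffRushClosure I = I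

/-- `a ∈ I` is superficial for `I` if, for some positive integer `c`,
`(I ^ (n + 1) : a) ∩ I ^ c = I ^ n` for all `n ≥ c`. -/
def IsSuperficial {R : Type*} [CommRing R] (I : Ideal R) (a : R) : Prop :=
  a ∈ I ∧ ∃ c : ℕ, 0 < c ∧ ∀ n : ℕ, c ≤ n → (I ^ (n + 1)).colon {a} ⊓ I ^ c = I ^ n

/-- The exponent vector of the monomial `X₁ ^ (l - 1) * X₂` (the variables `X₁, X₂` are those
with index `0, 1` in `Fin d`). -/
noncomputable def omittedExponent {d : ℕ} (hd : 2 ≤ d) (l : ℕ) : Fin d →₀ ℕ :=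
  Finsupp.single ⟨0, by omega⟩ (l - 1) + Finsupp.single ⟨1, by omega⟩ 1

/-- The ideal of `F[X₁, …, X_d]` generated by all the monomials of degree `l` except
`X₁ ^ (l - 1) * X₂`. -/
noncomputable def allButOneMonomialIdeal (F : Type*) [Field F] {d : ℕ} (hd : 2 ≤ d) (l : ℕ) :
    Ideal (MvPolynomial (Fin d) F) :=
  Ideal.span {m | ∃ s : Fin d →₀ ℕ, s.degree = l ∧ s ≠ omittedExponent hd l ∧
    m = MvPolynomial.monomial s 1}

/-!
Write `I` for the ideal generated by all monomials of degree `l` but `X₁ ^ (l - 1) * X₂`. For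
`n ≥ 1`, the power `I ^ n` is the span of all monomials of degree at least `n * l` except the single
monomial `wₙ = X₁ ^ (n * l - 1) * X₂` (`mem_allButOneMonomialIdeal_pow_iff`); the only difficulty is
to split each exponent into a generator of `I` and an exponent of `I ^ n`
(`exists_le_sub_mem_powerExponents`). Since `wₙ₊₁ = wₙ * X₁ ^ l`, an element `g ∈ I` satisfies
`wₙ * g ∈ I ^ (n + 1)` whenever `X₁ ^ l` does not occur in `g`
(`monomial_omittedExponent_mul_mem_pow`).

A superficial element `a` therefore involves `X₁ ^ l`: otherwise `wₙ` would lie in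
`(I ^ (n + 1) : a)` but not in `I ^ n`, for every `n` (`IsSuperficial.coeff_single_ne_zero`).
Consequently each `g ∈ I` differs by a scalar multiple of `a` from an element without `X₁ ^ l`, and
`w₁ * g ∈ I ^ 2 + (a)` (`monomial_omittedExponent_mem_colon`). As `a ∈ I` and `w₁ ∉ I`, the class of
`w₁` lies in the Ratliff-Rush closure of `I / (a)` but not in `I / (a)`.

Regularity of `I / (a)` is prime avoidance: the polynomial ring is factorial, and no prime element
divides all of `I`, as `I` contains `X₁ ^ l` and `X₂ ^ l`. So some element of `I` has no prime
factor in common with `a` (`isRegularIdeal_map_mk_span_singleton`).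
-/

open MvPolynomial

/-! ### Exponents -/

/-- The exponents `s` of the monomials spanning the `n`-th power of the ideal: those of degree at
least `n * l`, except the exponent of `X i ^ (n * l - 1) * X j`, which is described by its total
degree and its `i`-th and `j`-th entries. For `n = 0` nothing is excluded, as no exponent of
degree `0` has `j`-th entry `1`. -/
def powerExponents {σ : Type*} (i j : σ) (l n : ℕ) : Set (σ →₀ ℕ) :=
  {s | n * l ≤ s.degree ∧ ¬ (s.degree = n * l ∧ s i + 1 = n * l ∧ s j = 1)}

theorem degree_eq_add_degree_erase {σ : Type*} (i : σ) (s : σ →₀ ℕ) :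
    s.degree = s i + (s.erase i).degree := by
  conv_lhs => rw [← Finsupp.single_add_erase i s]
  rw [map_add, Finsupp.degree_single]

theorem apply_add_apply_le_degree {σ : Type*} {i j : σ} (hij : i ≠ j) (s : σ →₀ ℕ) :
    s i + s j ≤ s.degree := by
  have h := Finsupp.le_degree j (s.erase i)
  rw [Finsupp.erase_ne hij.symm] at h
  rw [degree_eq_add_degree_erase i s]
  omega

theorem eq_single_of_apply_eq_degree {σ : Type*} {i : σ} {s : σ →₀ ℕ} (h : s i = s.degree) :
    s = Finsupp.single i (s i) := by
  have h0 : (s.erase i).degree = 0 := by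
    have := degree_eq_add_degree_erase i s
    omega
  rw [Finsupp.degree_eq_zero_iff] at h0
  conv_lhs => rw [← Finsupp.single_add_erase i s, h0, add_zero]

/-- Below any exponent there is one of prescribed degree with prescribed `i`-th entry, as long as
the other entries can make up the difference. -/
theorem exists_le_apply_eq_degree_eq {σ : Type*} {i : σ} {s : σ →₀ ℕ} {p l : ℕ} (hp : p ≤ s i)
    (hpl : p ≤ l) (h : l + s i ≤ s.degree + p) : ∃ t ≤ s, t i = p ∧ t.degree = l := by
  classical
  obtain ⟨u, hu, hud⟩ := Finsupp.exists_le_degree_eq (s.erase i) (l - p) (by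
    have := degree_eq_add_degree_erase i s
    omega)
  have hui : u i = 0 := by simpa using hu i
  refine ⟨Finsupp.single i p + u, fun k ↦ ?_, by simp [hui], ?_⟩
  · rcases eq_or_ne k i with rfl | hk
    · simpa [hui] using hp
    · have := hu k
      rw [Finsupp.erase_ne hk] at this
      simpa [Finsupp.single_eq_of_ne hk] using this
  · rw [map_add, Finsupp.degree_single, hud]
    omega

theorem add_mem_powerExponents {σ : Type*} {i j : σ} (hij : i ≠ j) {l m n : ℕ} {s t : σ →₀ ℕ}
    (hs : s ∈ powerExponents i j l m) (ht : t ∈ powerExponents i j l n) :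
    s + t ∈ powerExponents i j l (m + n) := by
  obtain ⟨hs1, hs2⟩ := hs
  obtain ⟨ht1, ht2⟩ := ht
  have hs3 := apply_add_apply_le_degree hij s
  have ht3 := apply_add_apply_le_degree hij t
  rw [powerExponents, Set.mem_ofPred_eq, map_add, Finsupp.add_apply, Finsupp.add_apply, add_mul]
  generalize m * l = M at *
  generalize n * l = N at *
  omega

/-- The monomials spanning the `(n + 1)`-st power split off a generator of the ideal. This is where
`3 ≤ l` is needed: the product of `X i ^ (l - 1) * X j` with any monomial of degree `l` other than
`X i ^ l` can be regrouped so as to avoid the omitted generator. -/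
theorem exists_le_sub_mem_powerExponents {σ : Type*} {i j : σ} (hij : i ≠ j) {l n : ℕ} (hl : 3 ≤ l)
    {s : σ →₀ ℕ} (hs : s ∈ powerExponents i j l (n + 1)) :
    ∃ t ≤ s, t.degree = l ∧ t ∈ powerExponents i j l 1 ∧ s - t ∈ powerExponents i j l n := by
  obtain ⟨hs1, hs2⟩ := hs
  have hs3 := apply_add_apply_le_degree hij s
  have hn : n * l = 0 ∨ l ≤ n * l := by
    rcases Nat.eq_zero_or_pos n with rfl | h
    · simp
    · exact Or.inr (Nat.le_mul_of_pos_left l h)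
  rw [add_mul, one_mul] at hs1 hs2
  generalize hN : n * l = N at *
  -- It suffices to choose the `i`-th entry of `t`; the other entries are irrelevant.
  suffices h : ∃ t ≤ s, t.degree = l ∧ ¬ (t i + 1 = l ∧ t j = 1) ∧
      ¬ (s.degree = N + l ∧ s i + 1 = N + t i ∧ s j = 1 + t j) by
    obtain ⟨t, hts, htd, ht, hst⟩ := h
    have hd : s.degree = (s - t).degree + t.degree := by
      rw [← map_add, tsub_add_cancel_of_le hts]
    have hi := hts i
    have hj := hts j
    refine ⟨t, hts, htd, ?_, ?_⟩
    · rw [powerExponents, Set.mem_ofPred_eq, one_mul]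
      omega
    · rw [powerExponents, Set.mem_ofPred_eq, Finsupp.tsub_apply, Finsupp.tsub_apply, hN]
      omega
  by_cases hsi : l ≤ s i
  · refine ⟨Finsupp.single i l, by simpa using hsi, Finsupp.degree_single i l, ?_, ?_⟩
    · simp [Finsupp.single_eq_of_ne hij.symm]
    · rw [Finsupp.single_eq_same, Finsupp.single_eq_of_ne hij.symm]
      omega
  by_cases hsd : s.degree = l
  · exact ⟨s, le_rfl, hsd, by omega, by omega⟩
  · obtain ⟨t, hts, hti, htd⟩ := exists_le_apply_eq_degree_eq (i := i) (s := s)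
      (p := min (s i) (l - 2)) (l := l) (by omega) (by omega) (by omega)
    exact ⟨t, hts, htd, by omega, by omega⟩

/-! ### Powers of the ideal -/

theorem omittedExponent_eq_iff {d : ℕ} (hd : 2 ≤ d) {l : ℕ} (hl : 1 ≤ l) {s : Fin d →₀ ℕ} :
    s = omittedExponent hd l ↔
      s.degree = l ∧ s ⟨0, two_pos.trans_le hd⟩ + 1 = l ∧ s ⟨1, one_lt_two.trans_le hd⟩ = 1 := by
  have h01 : (⟨0, two_pos.trans_le hd⟩ : Fin d) ≠ ⟨1, one_lt_two.trans_le hd⟩ := by simp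
  constructor
  · rintro rfl
    simp only [omittedExponent, map_add, Finsupp.degree_single, Finsupp.add_apply,
      Finsupp.single_eq_same, Finsupp.single_eq_of_ne h01, Finsupp.single_eq_of_ne h01.symm]
    exact ⟨by omega, by omega, trivial⟩
  · rintro ⟨h1, h2, h3⟩
    have h4 := degree_eq_add_degree_erase ⟨0, two_pos.trans_le hd⟩ s
    have h5 : s.erase ⟨0, two_pos.trans_le hd⟩ ⟨1, one_lt_two.trans_le hd⟩ = 1 := by
      rw [Finsupp.erase_ne h01.symm, h3]
    have h6 := eq_single_of_apply_eq_degree (i := ⟨1, one_lt_two.trans_le hd⟩)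
      (s := s.erase ⟨0, two_pos.trans_le hd⟩) (by omega)
    rw [h5] at h6
    rw [omittedExponent, ← h6, show l - 1 = s ⟨0, two_pos.trans_le hd⟩ by omega,
      Finsupp.single_add_erase]

theorem allButOneMonomialIdeal_pow (F : Type*) [Field F] {d l : ℕ} (hd : 2 ≤ d) (hl : 3 ≤ l)
    (n : ℕ) : allButOneMonomialIdeal F hd l ^ n =
      Ideal.span ((fun s ↦ monomial s (1 : F)) ''
        powerExponents ⟨0, two_pos.trans_le hd⟩ ⟨1, one_lt_two.trans_le hd⟩ l n) := by
  have h01 : (⟨0, two_pos.trans_le hd⟩ : Fin d) ≠ ⟨1, one_lt_two.trans_le hd⟩ := by simp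
  induction n with
  | zero =>
    symm
    rw [pow_zero, Ideal.one_eq_top, Ideal.eq_top_iff_one]
    exact Ideal.subset_span ⟨0, by simp [powerExponents], rfl⟩
  | succ n ih =>
    rw [pow_succ, ih]
    apply le_antisymm
    · rw [allButOneMonomialIdeal, Ideal.span_mul_span', Ideal.span_le]
      rintro _ ⟨_, ⟨s, hs, rfl⟩, _, ⟨t, htd, ht, rfl⟩, rfl⟩
      rw [ne_eq, omittedExponent_eq_iff hd (by omega)] at ht
      refine Ideal.subset_span ⟨s + t, add_mem_powerExponents h01 hs ⟨by omega, ?_⟩, ?_⟩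
      · simpa using ht
      · simp [monomial_mul]
    · rw [Ideal.span_le]
      rintro _ ⟨s, hs, rfl⟩
      obtain ⟨t, hts, htd, ht, hst⟩ := exists_le_sub_mem_powerExponents h01 hl hs
      have hm : monomial s (1 : F) = monomial (s - t) 1 * monomial t 1 := by
        rw [monomial_mul, tsub_add_cancel_of_le hts, one_mul]
      change monomial s (1 : F) ∈ _
      rw [hm]
      refine Ideal.mul_mem_mul (Ideal.subset_span ⟨_, hst, rfl⟩)
        (Ideal.subset_span ⟨t, htd, fun h ↦ ht.2 ?_, rfl⟩)
      rw [omittedExponent_eq_iff hd (by omega)] at h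
      simpa using h

theorem mem_allButOneMonomialIdeal_pow_iff {F : Type*} [Field F] {d l : ℕ} (hd : 2 ≤ d)
    (hl : 3 ≤ l) {n : ℕ} {f : MvPolynomial (Fin d) F} :
    f ∈ allButOneMonomialIdeal F hd l ^ n ↔
      ∀ s ∈ f.support,
        s ∈ powerExponents ⟨0, two_pos.trans_le hd⟩ ⟨1, one_lt_two.trans_le hd⟩ l n := by
  rw [allButOneMonomialIdeal_pow F hd hl, mem_ideal_span_monomial_image]
  refine forall₂_congr fun s _ ↦ ⟨?_, fun hs ↦ ⟨s, hs, le_rfl⟩⟩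
  rintro ⟨t, ht, hts⟩
  have hd' := Finsupp.degree_mono hts
  refine ⟨ht.1.trans hd', fun h ↦ ?_⟩
  -- A multiple of `t` of the smallest possible degree is `t` itself.
  have hst : s.degree = (s - t).degree + t.degree := by
    rw [← map_add, tsub_add_cancel_of_le hts]
  have h0 : s - t = 0 := by
    rw [← Finsupp.degree_eq_zero_iff]
    have := ht.1
    omega
  rw [← tsub_add_cancel_of_le hts, h0, zero_add] at h
  exact ht.2 h

theorem mem_allButOneMonomialIdeal_iff {F : Type*} [Field F] {d l : ℕ} (hd : 2 ≤ d)
    (hl : 3 ≤ l) {f : MvPolynomial (Fin d) F} :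
    f ∈ allButOneMonomialIdeal F hd l ↔
      ∀ s ∈ f.support,
        s ∈ powerExponents ⟨0, two_pos.trans_le hd⟩ ⟨1, one_lt_two.trans_le hd⟩ l 1 := by
  rw [← mem_allButOneMonomialIdeal_pow_iff hd hl, pow_one]

/-! ### Superficial elements -/

/-- Multiplying `g ∈ I` by the monomial of degree `n * l` missing from `I ^ n` lands in
`I ^ (n + 1)` as soon as `X₁ ^ l` does not occur in `g`, since the monomial of degree
`(n + 1) * l` missing from `I ^ (n + 1)` is the missing monomial of `I ^ n` times `X₁ ^ l`. -/
theorem monomial_omittedExponent_mul_mem_pow {F : Type*} [Field F] {d l n : ℕ} (hd : 2 ≤ d)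
    (hl : 3 ≤ l) (hn : 1 ≤ n) {g : MvPolynomial (Fin d) F}
    (hg : g ∈ allButOneMonomialIdeal F hd l)
    (hg0 : coeff (Finsupp.single ⟨0, two_pos.trans_le hd⟩ l) g = 0) :
    monomial (omittedExponent hd (n * l)) 1 * g ∈ allButOneMonomialIdeal F hd l ^ (n + 1) := by
  have hnl : l ≤ n * l := Nat.le_mul_of_pos_left l hn
  rw [mem_allButOneMonomialIdeal_pow_iff hd hl]
  rw [mem_allButOneMonomialIdeal_iff hd hl] at hg
  intro s hs
  rw [mem_support_iff, coeff_monomial_mul'] at hs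
  split_ifs at hs with hle
  · rw [one_mul] at hs
    obtain ⟨r, rfl⟩ := exists_add_of_le hle
    rw [add_tsub_cancel_left] at hs
    have hr := (hg r (mem_support_iff.mpr hs)).1
    obtain ⟨he1, he2, he3⟩ := (omittedExponent_eq_iff hd (l := n * l) (by omega)).mp rfl
    rw [powerExponents, Set.mem_ofPred_eq, map_add, Finsupp.add_apply, Finsupp.add_apply, he1, he3,
      add_mul]
    rw [one_mul] at hr ⊢
    refine ⟨by omega, fun h ↦ ?_⟩
    have hri : r ⟨0, two_pos.trans_le hd⟩ = l := by omega
    have hrs := eq_single_of_apply_eq_degree (i := ⟨0, two_pos.trans_le hd⟩) (s := r) (by omega)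
    rw [hri] at hrs
    rw [hrs] at hs
    exact hs hg0
  · exact absurd rfl hs

theorem monomial_omittedExponent_notMem_pow {F : Type*} [Field F] {d l n : ℕ} (hd : 2 ≤ d)
    (hl : 3 ≤ l) (hn : 1 ≤ n) :
    monomial (omittedExponent hd (n * l)) (1 : F) ∉ allButOneMonomialIdeal F hd l ^ n := by
  have hnl : l ≤ n * l := Nat.le_mul_of_pos_left l hn
  rw [mem_allButOneMonomialIdeal_pow_iff hd hl]
  intro h
  exact (h (omittedExponent hd (n * l)) (by simp)).2
    ((omittedExponent_eq_iff hd (by omega)).mp rfl)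

/-- If `X₁ ^ l` did not occur in `a`, then `a` would multiply the monomial missing from `I ^ n`
into `I ^ (n + 1)` for every `n`. -/
theorem IsSuperficial.coeff_single_ne_zero {F : Type*} [Field F] {d l : ℕ} (hd : 2 ≤ d)
    (hl : 3 ≤ l) {a : MvPolynomial (Fin d) F}
    (ha : IsSuperficial (allButOneMonomialIdeal F hd l) a) :
    coeff (Finsupp.single ⟨0, two_pos.trans_le hd⟩ l) a ≠ 0 := by
  classical
  obtain ⟨haI, c, hc, h⟩ := ha
  intro h0
  have hcl : (c + 1) * l = c * l + l := by ring
  refine monomial_omittedExponent_notMem_pow (F := F) (n := c + 1) hd hl (by omega) ?_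
  rw [← h (c + 1) (by omega), Submodule.mem_inf, Submodule.mem_colon_singleton, smul_eq_mul]
  refine ⟨monomial_omittedExponent_mul_mem_pow hd hl (by omega) haI h0, ?_⟩
  rw [mem_allButOneMonomialIdeal_pow_iff hd hl]
  intro s hs
  rw [support_monomial, if_neg one_ne_zero, Finset.mem_singleton] at hs
  obtain ⟨he, -⟩ := (omittedExponent_eq_iff hd (by omega)).mp hs
  exact ⟨by omega, by omega⟩

/-- Modulo `a`, the monomial missing from `I` multiplies `I` into `I ^ 2`: subtracting a multiple
of `a` from `g ∈ I` removes the term in `X₁ ^ l`. -/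
theorem monomial_omittedExponent_mem_colon {F : Type*} [Field F] {d l : ℕ} (hd : 2 ≤ d)
    (hl : 3 ≤ l) {a : MvPolynomial (Fin d) F} (haI : a ∈ allButOneMonomialIdeal F hd l)
    (ha0 : coeff (Finsupp.single ⟨0, two_pos.trans_le hd⟩ l) a ≠ 0) :
    monomial (omittedExponent hd l) 1 ∈
      (allButOneMonomialIdeal F hd l ^ 2 ⊔ Ideal.span {a}).colon
        (allButOneMonomialIdeal F hd l) := by
  rw [Submodule.mem_colon]
  intro g hg
  set r : F := coeff (Finsupp.single ⟨0, two_pos.trans_le hd⟩ l) g /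
    coeff (Finsupp.single ⟨0, two_pos.trans_le hd⟩ l) a with hr
  have h1 := monomial_omittedExponent_mul_mem_pow (n := 1) hd hl le_rfl
    (g := g - C r * a) (sub_mem hg (Ideal.mul_mem_left _ _ haI)) (by
      rw [coeff_sub, coeff_C_mul, hr, div_mul_cancel₀ _ ha0, sub_self])
  rw [one_mul] at h1
  have h2 : monomial (omittedExponent hd l) 1 * C r * a ∈ Ideal.span {a} :=
    Ideal.mul_mem_left _ _ (Ideal.mem_span_singleton_self a)
  rw [smul_eq_mul]
  convert Submodule.add_mem_sup h1 h2 using 1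
  ring

/-! ### The quotient ideal -/

/-- Prime avoidance for the finitely many prime factors of `a`: if no prime divides all of `I`,
then some element of `I` is coprime to `a`. -/
theorem isRegularIdeal_map_mk_span_singleton {R : Type*} [CommRing R] [IsDomain R]
    [UniqueFactorizationMonoid R] {I : Ideal R} {a : R} (ha : a ≠ 0)
    (hI : ∀ p, Prime p → ¬ I ≤ Ideal.span {p}) :
    IsRegularIdeal (I.map (Ideal.Quotient.mk (Ideal.span {a}))) := by
  classical
  have hav : ¬ ((I : Set R) ⊆ ⋃ p ∈ (↑(UniqueFactorizationMonoid.factors a).toFinset : Set R),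
      (Ideal.span {p} : Ideal R)) := by
    rw [Ideal.subset_union_prime 0 0]
    · rintro ⟨p, hp, hle⟩
      exact hI p (UniqueFactorizationMonoid.prime_of_factor p (Multiset.mem_toFinset.mp hp)) hle
    · intro p hp _ _
      have hp' := UniqueFactorizationMonoid.prime_of_factor p (Multiset.mem_toFinset.mp hp)
      exact (Ideal.span_singleton_prime hp'.ne_zero).mpr hp'
  obtain ⟨f, hfI, hf⟩ := Set.not_subset.mp hav
  refine ⟨_, Ideal.mem_map_of_mem _ hfI, ?_⟩
  rw [mem_nonZeroDivisors_iff_right]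
  intro x hx
  obtain ⟨g, rfl⟩ := Ideal.Quotient.mk_surjective x
  rw [← map_mul, Ideal.Quotient.eq_zero_iff_dvd] at hx
  rw [Ideal.Quotient.eq_zero_iff_dvd]
  refine UniqueFactorizationMonoid.dvd_of_dvd_mul_left_of_no_prime_factors ha ?_ hx
  intro q hqa hqf hq
  obtain ⟨p, hp, hqp⟩ :=
    UniqueFactorizationMonoid.exists_mem_factors_of_dvd ha hq.irreducible hqa
  apply hf
  simp only [Set.mem_iUnion]
  exact ⟨p, by simpa using hp, Ideal.mem_span_singleton.mpr (hqp.symm.dvd.trans hqf)⟩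

theorem not_allButOneMonomialIdeal_le_span_prime {F : Type*} [Field F] {d l : ℕ} (hd : 2 ≤ d)
    (hl : 3 ≤ l) {p : MvPolynomial (Fin d) F} (hp : Prime p) :
    ¬ allButOneMonomialIdeal F hd l ≤ Ideal.span {p} := by
  intro hle
  -- The powers `X k ^ l` are never omitted, as both entries of the omitted exponent are positive.
  have key : ∀ k : Fin d, p ∣ X k := by
    intro k
    refine hp.dvd_of_dvd_pow (n := l) (Ideal.mem_span_singleton.mp (hle (Ideal.subset_span
      ⟨Finsupp.single k l, Finsupp.degree_single k l, ?_, X_pow_eq_monomial⟩)))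
    rw [ne_eq, omittedExponent_eq_iff hd (by omega)]
    rintro ⟨-, h2, h3⟩
    rw [Finsupp.single_apply] at h2 h3
    split_ifs at h2 h3 <;> omega
  have h := (hp.associated_of_dvd X_prime (key ⟨0, two_pos.trans_le hd⟩)).symm.dvd.trans
    (key ⟨1, one_lt_two.trans_le hd⟩)
  rw [X_dvd_X] at h
  simp at h

/-- The condition on `x` says that `x` lies in `(I ^ 2 : I)` modulo `J`. -/
theorem not_isRatliffRushClosed_map_mk {R : Type*} [CommRing R] {I J : Ideal R} (hJI : J ≤ I)
    {x : R} (hx : x ∈ (I ^ 2 ⊔ J).colon I) (hxI : x ∉ I) :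
    ¬ IsRatliffRushClosed (I.map (Ideal.Quotient.mk J)) := by
  rintro ⟨-, h⟩
  apply hxI
  rw [← Ideal.comap_map_mk hJI, Ideal.mem_comap, ← h]
  refine ⟨1, ?_⟩
  rw [Submodule.mem_colon, pow_one]
  intro y hy
  obtain ⟨g, hg, rfl⟩ := (Ideal.mem_map_iff_of_surjective _ Ideal.Quotient.mk_surjective).mp hy
  rw [smul_eq_mul, ← map_mul, ← Ideal.map_pow, Ideal.mem_quotient_iff_mem_sup]
  exact Submodule.mem_colon.mp hx g hg

theorem proposition2p4 (F : Type*) [Field F] (d l : ℕ) (hd : 2 ≤ d) (hl : 3 ≤ l)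
    (a : MvPolynomial (Fin d) F) (ha : IsSuperficial (allButOneMonomialIdeal F hd l) a) :
    IsRegularIdeal ((allButOneMonomialIdeal F hd l).map (Ideal.Quotient.mk (Ideal.span {a}))) ∧
    ¬ IsRatliffRushClosed
      ((allButOneMonomialIdeal F hd l).map (Ideal.Quotient.mk (Ideal.span {a}))) ∧
    (MvPolynomial.X ⟨0, by omega⟩ ^ (l - 1) * MvPolynomial.X ⟨1, by omega⟩ :
        MvPolynomial (Fin d) F) ∈
      ((allButOneMonomialIdeal F hd l) ^ 2 ⊔ Ideal.span {a}).colon (allButOneMonomialIdeal F hd l) ∧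
    (MvPolynomial.X ⟨0, by omega⟩ ^ (l - 1) * MvPolynomial.X ⟨1, by omega⟩ :
        MvPolynomial (Fin d) F) ∉ allButOneMonomialIdeal F hd l := by
  have hw : (X ⟨0, by omega⟩ ^ (l - 1) * X ⟨1, by omega⟩ : MvPolynomial (Fin d) F) =
      monomial (omittedExponent hd l) 1 := by
    rw [omittedExponent, X_pow_eq_monomial, X, monomial_mul, one_mul]
  rw [hw]
  have ha0 := ha.coeff_single_ne_zero hd hl
  have hne : a ≠ 0 := by
    rintro rfl
    exact ha0 (coeff_zero _)
  have hmem := monomial_omittedExponent_mem_colon hd hl ha.1 ha0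
  have hnot := monomial_omittedExponent_notMem_pow (F := F) (n := 1) hd hl le_rfl
  rw [one_mul, pow_one] at hnot
  exact ⟨isRegularIdeal_map_mk_span_singleton hne
      fun p hp ↦ not_allButOneMonomialIdeal_le_span_prime hd hl hp,
    not_isRatliffRushClosed_map_mk ((Ideal.span_singleton_le_iff_mem _).mpr ha.1) hmem hnot,
    hmem, hnot⟩
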